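/- Let $d,m\in\mathbb N$, $\varepsilon>0$. Let $X$ be an $\mathbb R^d$-valued random variable with a strictly positive density $f_X$, and let $Z$ be the $\mathbb R^m$-valued output of a randomized mechanism with strictly positive conditional density $p_Z(z\mid x)$, so that $(X,Z)$ has joint density $f_X(x)\,p_Z(z\mid x)$. Assume: (i) $x\mapsto\log f_X(x)$ and, for every $z$, $x\mapsto\log p_Z(z\mid x)$ are twice differentiable on $\mathbb R^d$; (ii) the mechanism is $\varepsilon$-Lipschitz private in the gradient form: $\|\nabla_x\log p_Z(z\mid x)\|^2\le\varepsilon^2$ for all $x,z$ (Euclidean norm); (iii) the Fisher information matrix $\mathcal I(f_X)=\mathbb E_{x\sim f_X}[\nabla\log f_X(x)\,\nabla\log f_X(x)^T]$ of the prior is finite; (iv) with $\mathcal I_{Z|X}(x)=\mathbb E_{z\sim p_Z(\cdot\mid x)}[\nabla_x\log p_Z(z\mid x)\,\nabla_x\log p_Z(z\mid x)^T]$, the null spaces of $\mathcal I_{Z|X}(x)$ and $\mathcal I(f_X)$ intersect only in $0$, for every $x$. Let $A:\mathbb R^m\to\mathbb R^d$ be any (measurable) estimator whose conditional mean $\mu(x)=\mathbb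 E_{z\sim p_Z(\cdot\mid x)}[A(z)]$ exists for every $x$. Then $\mu$ is differentiable, with Jacobian $J_\mu(x)$ say, the matrix $\mathcal I_{Z|X}(x)+\mathcal I(f_X)$ is positive definite for every $x$, and the reconstruction error $R(A)=\mathbb E\|A(Z)-X\|^2\in[0,\infty]$ satisfies $$R(A)\ \ge\ \mathbb E_{x\sim f_X}\Big[\operatorname{Tr}\big(J_\mu(x)\,(\mathcal I_{Z|X}(x)+\mathcal I(f_X))^{-1}J_\mu(x)^T\big)+\|\mu(x)-x\|^2\Big].$$ If moreover $\mu(x)=x$ for all $x$, then $$R(A)\ \ge\ \mathbb E_{x\sim f_X}\Big[\operatorname{Tr}\big((\mathcal I_{Z|X}(x)+\mathcal I(f_X))^{-1}\big)\Big]\ \ge\ \frac{d^2}{\varepsilon^2+\operatorname{Tr}\mathcal I(f_X)},$$ and in fact $\operatorname{Tr}\big((\mathcal I_{Z|X}(x)+\mathcal I(f_X))^{-1}\big)\ge d^2/(\varepsilon^2+\operatorname{Tr}\mathcal I(f_X))$ for every $x$. -/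

import Mathlib

open MeasureTheory ProbabilityTheory

noncomputable section

namespace Reconstruction

/-- A strictly positive (Lebesgue) probability density on `ℝⁿ`. -/
structure IsPosDensity {n : ℕ} (g : EuclideanSpace ℝ (Fin n) → ℝ) : Prop where
  measurable : Measurable g
  pos : ∀ y, 0 < g y
  lintegral_eq_one : ∫⁻ y, ENNReal.ofReal (g y) = 1

/-- A strictly positive conditional density `p x z = p_Z(z | x)` on `ℝᵐ` given `x ∈ ℝᵈ`. -/
structure IsPosCondDensity {d m : ℕ}
    (p : EuclideanSpace ℝ (Fin d) → EuclideanSpace ℝ (Fin m) → ℝ) : Prop where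
  measurable : Measurable (Function.uncurry p)
  density : ∀ x, IsPosDensity (p x)

/-- The measure on `ℝⁿ` with Lebesgue density `g`. -/
def law {n : ℕ} (g : EuclideanSpace ℝ (Fin n) → ℝ) : Measure (EuclideanSpace ℝ (Fin n)) :=
  volume.withDensity fun y => ENNReal.ofReal (g y)

/-- The joint law of `(X, Z)`: the measure on `ℝᵈ × ℝᵐ` with Lebesgue density
`f_X(x) p_Z(z | x)`. -/
def jointLaw {d m : ℕ} (f : EuclideanSpace ℝ (Fin d) → ℝ)
    (p : EuclideanSpace ℝ (Fin d) → EuclideanSpace ℝ (Fin m) → ℝ) :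
    Measure (EuclideanSpace ℝ (Fin d) × EuclideanSpace ℝ (Fin m)) :=
  volume.withDensity fun w => ENNReal.ofReal (f w.1 * p w.1 w.2)

/-- Twice differentiability on `ℝᵈ` (no continuity of the second derivative is required). -/
def TwiceDifferentiable {d : ℕ} (g : EuclideanSpace ℝ (Fin d) → ℝ) : Prop :=
  Differentiable ℝ g ∧ Differentiable ℝ (gradient g)

/-- The score `∇ₓ log f_X(x)` of the prior. -/
def priorScore {d : ℕ} (f : EuclideanSpace ℝ (Fin d) → ℝ) (x : EuclideanSpace ℝ (Fin d)) :
    EuclideanSpace ℝ (Fin d) :=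
  gradient (fun x' => Real.log (f x')) x

/-- The score `∇ₓ log p_Z(z | x)` of the mechanism. -/
def condScore {d m : ℕ} (p : EuclideanSpace ℝ (Fin d) → EuclideanSpace ℝ (Fin m) → ℝ)
    (x : EuclideanSpace ℝ (Fin d)) (z : EuclideanSpace ℝ (Fin m)) : EuclideanSpace ℝ (Fin d) :=
  gradient (fun x' => Real.log (p x' z)) x

/-- `ε`-Lipschitz privacy of a mechanism with differentiable conditional density, as the
pointwise bound on the gradient of the log density. -/
def IsLipschitzPrivate {d m : ℕ} (ε : ℝ)
    (p : EuclideanSpace ℝ (Fin d) → EuclideanSpace ℝ (Fin m) → ℝ) : Prop :=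
  ∀ x z, ‖condScore p x z‖ ^ 2 ≤ ε ^ 2

/-- The Fisher information matrix `I(f_X) = E_x[∇ log f_X(x) ∇ log f_X(x)ᵀ]` of the prior. -/
def priorFisher {d : ℕ} (f : EuclideanSpace ℝ (Fin d) → ℝ) : Matrix (Fin d) (Fin d) ℝ :=
  Matrix.of fun i j => ∫ x, priorScore f x i * priorScore f x j ∂(law f)

/-- All entries of `I(f_X)` are finite, i.e. the defining integrals converge. -/
def FinitePriorFisher {d : ℕ} (f : EuclideanSpace ℝ (Fin d) → ℝ) : Prop :=
  ∀ i j, Integrable (fun x => priorScore f x i * priorScore f x j) (law f)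

/-- The conditional Fisher information matrix
`I_{Z|X}(x) = E_{z ∼ p_Z(· | x)}[∇ₓ log p_Z(z | x) ∇ₓ log p_Z(z | x)ᵀ]`. -/
def condFisher {d m : ℕ} (p : EuclideanSpace ℝ (Fin d) → EuclideanSpace ℝ (Fin m) → ℝ)
    (x : EuclideanSpace ℝ (Fin d)) : Matrix (Fin d) (Fin d) ℝ :=
  Matrix.of fun i j => ∫ z, condScore p x z i * condScore p x z j ∂(law (p x))

/-- The matrix `I_{Z|X}(x) + I(f_X)`. -/
def totalFisher {d m : ℕ} (f : EuclideanSpace ℝ (Fin d) → ℝ)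
    (p : EuclideanSpace ℝ (Fin d) → EuclideanSpace ℝ (Fin m) → ℝ)
    (x : EuclideanSpace ℝ (Fin d)) : Matrix (Fin d) (Fin d) ℝ :=
  condFisher p x + priorFisher f

/-- The conditional mean `μ(x) = E_{z ∼ p_Z(· | x)}[A(z)]` of an estimator `A`. -/
def condMean {d m : ℕ} (p : EuclideanSpace ℝ (Fin d) → EuclideanSpace ℝ (Fin m) → ℝ)
    (A : EuclideanSpace ℝ (Fin m) → EuclideanSpace ℝ (Fin d)) (x : EuclideanSpace ℝ (Fin d)) :
    EuclideanSpace ℝ (Fin d) :=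
  ∫ z, A z ∂(law (p x))

/-- The Jacobian matrix `(∂ uᵢ / ∂ xⱼ)ᵢⱼ` of a vector field on `ℝᵈ`. -/
def jacobian {d : ℕ} (u : EuclideanSpace ℝ (Fin d) → EuclideanSpace ℝ (Fin d))
    (x : EuclideanSpace ℝ (Fin d)) : Matrix (Fin d) (Fin d) ℝ :=
  Matrix.of fun i j => fderiv ℝ u x (EuclideanSpace.single j 1) i

/-- The reconstruction error `R(A) = E ‖A(Z) - X‖²`, as an element of `[0, ∞]`. -/
def reconstructionError {Ω : Type*} [MeasurableSpace Ω] (P : Measure Ω) {d m : ℕ}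
    (X : Ω → EuclideanSpace ℝ (Fin d)) (Z : Ω → EuclideanSpace ℝ (Fin m))
    (A : EuclideanSpace ℝ (Fin m) → EuclideanSpace ℝ (Fin d)) : ENNReal :=
  ∫⁻ ω, ENNReal.ofReal (‖A (Z ω) - X ω‖ ^ 2) ∂P

end Reconstruction

end

/-! Privacy bounds the score `S = ∇ₓ log p_Z(z | x)` by `ε`, so `p_Z(· | y)` is dominated by a
multiple of `p_Z(· | x)` for `y` near `x`, and integrals against `p_Z(· | x)` may be differentiated
in `x` under the integral sign. Hence the score is centred and the Jacobian of the conditional mean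
is the covariance of `A` with `S`. Conditionally on `X = x`, the error of `A` splits into its
variance and its squared bias, and Cramér–Rao bounds the variance of each coordinate of `A` from
below. Adding a positive semidefinite matrix `K` to the information only weakens this bound; the
Fisher information of the prior enters in no other way, so it may be replaced by any such `K` and
the prior by any probability measure. For unbiased `A` the Jacobian is the identity, and the
arithmetic–harmonic mean inequality for eigenvalues bounds the trace of the inverse. -/

namespace Reconstruction

open Filter InnerProductSpace Matrix
open scoped Topology

section PositiveMatrices

variable {ι 𝕜 : Type*} [Fintype ι]

open scoped ComplexOrder in
lemma posDef_add_of_ker_inf_ker_eq_bot [RCLike 𝕜] {M N : Matrix ι ι 𝕜} (hM : M.PosSemidef)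
    (hN : N.PosSemidef) (h : LinearMap.ker M.mulVecLin ⊓ LinearMap.ker N.mulVecLin = ⊥) :
    (M + N).PosDef := by
  refine PosDef.of_dotProduct_mulVec_pos (hM.add hN).isHermitian fun v hv => ?_
  have hMv := hM.dotProduct_mulVec_nonneg v
  have hNv := hN.dotProduct_mulVec_nonneg v
  rw [add_mulVec, dotProduct_add]
  refine (add_nonneg hMv hNv).lt_of_ne' fun h0 => hv ?_
  obtain ⟨hM0, hN0⟩ := (add_eq_zero_iff_of_nonneg hMv hNv).1 h0
  have hker : v ∈ LinearMap.ker M.mulVecLin ⊓ LinearMap.ker N.mulVecLin :=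
    ⟨(hM.dotProduct_mulVec_zero_iff v).1 hM0, (hN.dotProduct_mulVec_zero_iff v).1 hN0⟩
  simpa only [h, Submodule.mem_bot] using hker

lemma trace_mul_mul_transpose_eq_sum {κ : Type*} [Fintype κ] (J : Matrix κ ι ℝ)
    (M : Matrix ι ι ℝ) : (J * M * Jᵀ).trace = ∑ i, J i ⬝ᵥ M *ᵥ J i := by
  simp only [dotProduct_mulVec]
  rfl

variable [DecidableEq ι]

lemma trace_one_sub_smul_mul_inv_mul {M : Matrix ι ι ℝ} (hM : M.PosDef) (c : ℝ) :
    ((1 - c • M) * M⁻¹ * (1 - c • M)ᴴ).trace =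
      M⁻¹.trace - 2 * c * Fintype.card ι + c ^ 2 * M.trace := by
  have hdet : IsUnit M.det := hM.det_pos.ne'.isUnit
  have hexpand : (1 - c • M) * M⁻¹ * (1 - c • M)ᴴ = M⁻¹ - (2 * c) • 1 + c ^ 2 • M := by
    simp only [conjTranspose_sub, conjTranspose_one, conjTranspose_smul, star_trivial,
      hM.isHermitian.eq, sub_mul, mul_sub, one_mul, mul_one, smul_mul_assoc, mul_smul_comm,
      M.mul_nonsing_inv hdet, M.nonsing_inv_mul hdet]
    module
  simp only [hexpand, trace_add, trace_sub, trace_smul, trace_one, smul_eq_mul]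

-- Arithmetic–harmonic mean: with `c = n / t`, the trace of `(1 - cM) M⁻¹ (1 - cM)ᴴ` is nonnegative.
lemma sq_card_div_le_trace_inv {M : Matrix ι ι ℝ} (hM : M.PosDef) {t : ℝ} (ht : M.trace ≤ t) :
    (Fintype.card ι : ℝ) ^ 2 / t ≤ M⁻¹.trace := by
  set c : ℝ := Fintype.card ι / t with hc
  have hnonneg := (hM.inv.posSemidef.mul_mul_conjTranspose_same (1 - c • M)).trace_nonneg
  rw [trace_one_sub_smul_mul_inv_mul hM] at hnonneg
  have hct : c ^ 2 * t = c * Fintype.card ι := by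
    rcases eq_or_ne t 0 with rfl | ht0
    · simp [hc]
    · rw [hc]; field_simp
  calc (Fintype.card ι : ℝ) ^ 2 / t = 2 * c * Fintype.card ι - c ^ 2 * t := by
        rw [hct, hc]; ring
    _ ≤ 2 * c * Fintype.card ι - c ^ 2 * M.trace := by gcongr
    _ ≤ M⁻¹.trace := by linarith

end PositiveMatrices

section SecondMoments

variable {α ι : Type*} [MeasurableSpace α] {ν : Measure α}

/-- The second moment matrix `E[S Sᵀ]` of a family `S` of real random variables; the Fisher
information matrices are the second moment matrices of the scores. -/
noncomputable def secondMoment (ν : Measure α) (S : ι → α → ℝ) : Matrix ι ι ℝ :=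
  Matrix.of fun i j => ∫ a, S i a * S j a ∂ν

variable {S : ι → α → ℝ}

lemma integral_sum_mul_sq [Fintype ι] (hS : ∀ i j, Integrable (fun a => S i a * S j a) ν)
    (v : ι → ℝ) : ∫ a, (∑ i, v i * S i a) ^ 2 ∂ν = v ⬝ᵥ secondMoment ν S *ᵥ v := by
  have hexpand : ∀ a, (∑ i, v i * S i a) ^ 2 = ∑ i, ∑ j, v i * v j * (S i a * S j a) := fun a => by
    simp only [sq, Finset.sum_mul_sum, mul_mul_mul_comm]
  have hint : ∀ i j, Integrable (fun a => v i * v j * (S i a * S j a)) ν := fun i j =>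
    (hS i j).const_mul (v i * v j)
  simp only [hexpand]
  rw [integral_finsetSum _ fun i _ => integrable_finsetSum _ fun j _ => hint i j]
  simp only [dotProduct, mulVec, secondMoment, Matrix.of_apply, Finset.mul_sum]
  refine Finset.sum_congr rfl fun i _ => ?_
  rw [integral_finsetSum _ fun j _ => hint i j]
  refine Finset.sum_congr rfl fun j _ => ?_
  rw [integral_const_mul]
  ring

lemma posSemidef_secondMoment [Finite ι]
    (hS : ∀ i j, Integrable (fun a => S i a * S j a) ν) : (secondMoment ν S).PosSemidef := by
  have := Fintype.ofFinite ι
  refine PosSemidef.of_dotProduct_mulVec_nonneg ?_ fun v => ?_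
  · ext i j
    simp [secondMoment, mul_comm]
  · rw [star_trivial, ← integral_sum_mul_sq hS v]
    exact integral_nonneg fun a => sq_nonneg _

lemma trace_secondMoment [Fintype ι] (hS : ∀ i, Integrable (fun a => S i a * S i a) ν) :
    (secondMoment ν S).trace = ∫ a, ∑ i, S i a ^ 2 ∂ν := by
  simp only [sq]
  rw [integral_finsetSum _ fun i _ => hS i]
  rfl

end SecondMoments

section CramerRao

variable {α ι : Type*} [MeasurableSpace α] {ν : Measure α} [IsProbabilityMeasure ν] [Fintype ι]

-- The variance of the residual `Y - ∑ i, b i * S i` is nonnegative for `b = M⁻¹ c`.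
lemma cov_dotProduct_inv_mulVec_cov_le_variance [DecidableEq ι] {Y : α → ℝ} {S : ι → α → ℝ}
    (hY : MemLp Y 2 ν) (hS : ∀ i, MemLp (S i) 2 ν) {M : Matrix ι ι ℝ} (hM : M.PosDef)
    (hSM : (M - secondMoment ν S).PosSemidef) :
    (fun i => cov[Y, S i; ν]) ⬝ᵥ M⁻¹ *ᵥ (fun i => cov[Y, S i; ν]) ≤ Var[Y; ν] := by
  set c : ι → ℝ := fun i => cov[Y, S i; ν]
  set b : ι → ℝ := M⁻¹ *ᵥ c with hb
  set L : α → ℝ := fun a => ∑ i, b i * S i a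
  have hbS : ∀ i, MemLp (fun a => b i * S i a) 2 ν := fun i => (hS i).const_mul (b i)
  have hL : MemLp L 2 ν := memLp_finsetSum _ fun i _ => hbS i
  have hcov : cov[Y, L; ν] = c ⬝ᵥ b := by
    simp only [L, covariance_fun_sum_right hbS hY, covariance_const_mul_right]
    exact dotProduct_comm b c
  have hMb : M *ᵥ b = c := by
    rw [hb, mulVec_mulVec, M.mul_nonsing_inv hM.det_pos.ne'.isUnit, one_mulVec]
  have hvar : Var[L; ν] ≤ c ⬝ᵥ b := by
    have hres := hSM.dotProduct_mulVec_nonneg b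
    rw [star_trivial, sub_mulVec, dotProduct_sub, hMb, dotProduct_comm b c, sub_nonneg] at hres
    calc Var[L; ν] ≤ ∫ a, L a ^ 2 ∂ν := variance_le_expectation_sq hL.1
      _ = b ⬝ᵥ secondMoment ν S *ᵥ b :=
          integral_sum_mul_sq (fun i j => (hS i).integrable_mul (hS j)) b
      _ ≤ c ⬝ᵥ b := hres
  have hsub := variance_sub hY hL
  linarith [variance_nonneg (Y - L) ν]

lemma integral_sub_sq_eq_variance_add {Y : α → ℝ} (hY : MemLp Y 2 ν) (c : ℝ) :
    ∫ a, (Y a - c) ^ 2 ∂ν = Var[Y; ν] + (∫ a, Y a ∂ν - c) ^ 2 := by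
  have h := variance_eq_sub (hY.sub (memLp_const c))
  rw [show Y - (fun _ => c) = fun a => Y a - c from rfl, variance_sub_const hY.1,
    integral_sub (hY.integrable one_le_two) (integrable_const c)] at h
  simp only [Pi.pow_apply, integral_const, probReal_univ, one_smul] at h
  linarith

lemma integral_norm_sub_sq_eq_sum_variance_add {Y : α → EuclideanSpace ℝ ι} (hY : MemLp Y 2 ν)
    (c : EuclideanSpace ℝ ι) :
    ∫ a, ‖Y a - c‖ ^ 2 ∂ν = ∑ i, Var[fun a => Y a i; ν] + ‖∫ a, Y a ∂ν - c‖ ^ 2 := by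
  have hYi : ∀ i, MemLp (fun a => Y a i) 2 ν := hY.eval_piLp
  have hmean : ∀ i, (∫ a, Y a ∂ν) i = ∫ a, Y a i ∂ν :=
    eval_integral_piLp (hY.integrable one_le_two).eval_piLp
  have hsq : ∀ i, Integrable (fun a => (Y a i - c i) ^ 2) ν := fun i =>
    ((hYi i).sub (memLp_const (c i))).integrable_sq
  simp only [EuclideanSpace.real_norm_sq_eq, PiLp.sub_apply, hmean]
  rw [integral_finsetSum _ fun i _ => hsq i, ← Finset.sum_add_distrib]
  exact Finset.sum_congr rfl fun i _ => integral_sub_sq_eq_variance_add (hYi i) (c i)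

end CramerRao

section Densities

variable {n : ℕ} {g : EuclideanSpace ℝ (Fin n) → ℝ} {F : Type*} [NormedAddCommGroup F]
  [NormedSpace ℝ F]

lemma IsPosDensity.isProbabilityMeasure (hg : IsPosDensity g) : IsProbabilityMeasure (law g) :=
  ⟨by rw [law, withDensity_apply _ .univ, Measure.restrict_univ, hg.lintegral_eq_one]⟩

lemma IsPosDensity.volume_absolutelyContinuous_law (hg : IsPosDensity g) : volume ≪ law g :=
  withDensity_absolutelyContinuous' hg.measurable.ennreal_ofReal.aemeasurable
    (.of_forall fun y => (ENNReal.ofReal_pos.2 (hg.pos y)).ne')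

lemma IsPosDensity.integrable_law_iff (hg : IsPosDensity g) {h : EuclideanSpace ℝ (Fin n) → F} :
    Integrable h (law g) ↔ Integrable fun y => g y • h y := by
  rw [law, integrable_withDensity_iff_integrable_smul' hg.measurable.ennreal_ofReal
    (.of_forall fun _ => ENNReal.ofReal_lt_top)]
  simp only [ENNReal.toReal_ofReal (hg.pos _).le]

lemma IsPosDensity.integral_law (hg : IsPosDensity g) (h : EuclideanSpace ℝ (Fin n) → F) :
    ∫ y, h y ∂(law g) = ∫ y, g y • h y := by
  rw [law, integral_withDensity_eq_integral_toReal_smul hg.measurable.ennreal_ofReal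
    (.of_forall fun _ => ENNReal.ofReal_lt_top)]
  simp only [ENNReal.toReal_ofReal (hg.pos _).le]

end Densities

lemma measurable_fderiv_apply_of_measurable {E F β : Type*} [NormedAddCommGroup E]
    [NormedSpace ℝ E] [NormedAddCommGroup F] [NormedSpace ℝ F] [MeasurableSpace F] [BorelSpace F]
    [SecondCountableTopology F] [MeasurableSpace β] {q : E → β → F} (hq : ∀ y, Measurable (q y))
    {x : E} (hdiff : ∀ z, DifferentiableAt ℝ (fun y => q y z) x) (v : E) :
    Measurable fun z => fderiv ℝ (fun y => q y z) x v := by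
  have hlim : ∀ z, Tendsto (fun k : ℕ => (k : ℝ) • (q (x + (k : ℝ)⁻¹ • v) z - q x z)) atTop
      (𝓝 (fderiv ℝ (fun y => q y z) x v)) := fun z =>
    (hdiff z).hasFDerivAt.lim v (by simpa using tendsto_natCast_atTop_atTop (R := ℝ))
  exact measurable_of_tendsto_metrizable (fun k => ((hq _).sub (hq x)).const_smul (k : ℝ))
    (tendsto_pi_nhds.2 hlim)

variable {d m : ℕ} {ε : ℝ} {p : EuclideanSpace ℝ (Fin d) → EuclideanSpace ℝ (Fin m) → ℝ}

section Score

lemma norm_condScore_le (hpriv : IsLipschitzPrivate ε p) (x : EuclideanSpace ℝ (Fin d))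
    (z : EuclideanSpace ℝ (Fin m)) : ‖condScore p x z‖ ≤ |ε| := by
  simpa only [abs_norm] using sq_le_sq.1 (hpriv x z)

lemma hasFDerivAt_log_condDensity {x : EuclideanSpace ℝ (Fin d)} {z : EuclideanSpace ℝ (Fin m)}
    (hdiff : DifferentiableAt ℝ (fun y => Real.log (p y z)) x) :
    HasFDerivAt (fun y => Real.log (p y z)) (innerSL ℝ (condScore p x z)) x :=
  hdiff.hasGradientAt.hasFDerivAt

lemma hasFDerivAt_condDensity (hp : IsPosCondDensity p) {x : EuclideanSpace ℝ (Fin d)}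
    {z : EuclideanSpace ℝ (Fin m)} (hdiff : DifferentiableAt ℝ (fun y => Real.log (p y z)) x) :
    HasFDerivAt (fun y => p y z) (p x z • innerSL ℝ (condScore p x z)) x := by
  simpa only [Real.exp_log ((hp.density _).pos z)] using (hasFDerivAt_log_condDensity hdiff).exp

lemma condDensity_le_exp_mul (hp : IsPosCondDensity p) {z : EuclideanSpace ℝ (Fin m)}
    (hdiff : Differentiable ℝ fun x => Real.log (p x z)) (hpriv : IsLipschitzPrivate ε p)
    (x y : EuclideanSpace ℝ (Fin d)) :
    p y z ≤ Real.exp (|ε| * ‖y - x‖) * p x z := by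
  have hlip : ‖Real.log (p y z) - Real.log (p x z)‖ ≤ |ε| * ‖y - x‖ :=
    convex_univ.norm_image_sub_le_of_norm_hasFDerivWithin_le
      (fun w _ => (hasFDerivAt_log_condDensity (hdiff w)).hasFDerivWithinAt)
      (fun w _ => (innerSL_apply_norm (𝕜 := ℝ) _).trans_le (norm_condScore_le hpriv w z))
      (Set.mem_univ x) (Set.mem_univ y)
  have hle := (le_abs_self _).trans hlip
  rw [← Real.exp_log ((hp.density y).pos z), ← Real.exp_log ((hp.density x).pos z), ← Real.exp_add]
  exact Real.exp_le_exp.2 (by simpa only [Real.exp_log ((hp.density _).pos z)] using by linarith)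

lemma measurable_condScore (hp : IsPosCondDensity p) {x : EuclideanSpace ℝ (Fin d)}
    (hdiff : ∀ z, DifferentiableAt ℝ (fun y => Real.log (p y z)) x) :
    Measurable (condScore p x) := by
  have hcoord : ∀ i, Measurable fun z => condScore p x z i := fun i => by
    have hi := measurable_fderiv_apply_of_measurable (fun y => (hp.density y).measurable.log) hdiff
      (EuclideanSpace.single i 1)
    simpa only [condScore, ← inner_gradient_left, EuclideanSpace.inner_single_right, one_mul,
      conj_trivial] using hi
  exact (WithLp.measurable_toLp 2 _).comp (measurable_pi_iff.2 hcoord)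

lemma memLp_condScore (hp : IsPosCondDensity p) {x : EuclideanSpace ℝ (Fin d)}
    (hdiff : ∀ z, DifferentiableAt ℝ (fun y => Real.log (p y z)) x)
    (hpriv : IsLipschitzPrivate ε p) (r : ENNReal) : MemLp (condScore p x) r (law (p x)) :=
  have := (hp.density x).isProbabilityMeasure
  .of_bound (measurable_condScore hp hdiff).aestronglyMeasurable |ε|
    (.of_forall (norm_condScore_le hpriv x))

end Score

section Differentiation

variable {F : Type*} [NormedAddCommGroup F] [NormedSpace ℝ F] {h : EuclideanSpace ℝ (Fin m) → F}

lemma integrable_rankOne_condScore (hp : IsPosCondDensity p) {x : EuclideanSpace ℝ (Fin d)}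
    (hdiff : ∀ z, DifferentiableAt ℝ (fun y => Real.log (p y z)) x)
    (hpriv : IsLipschitzPrivate ε p) (hh : Integrable h (law (p x))) :
    Integrable (fun z => rankOne ℝ (h z) (condScore p x z)) (law (p x)) := by
  have hcont : Continuous fun w : F × EuclideanSpace ℝ (Fin d) => rankOne ℝ w.1 w.2 :=
    (rankOne ℝ (E := F) (F := EuclideanSpace ℝ (Fin d))).continuous₂
  have hmeas := hcont.comp_aestronglyMeasurable
    (hh.1.prodMk (measurable_condScore hp hdiff).aestronglyMeasurable)
  refine (hh.norm.mul_const |ε|).mono' hmeas (.of_forall fun z => ?_)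
  rw [norm_rankOne]
  gcongr
  exact norm_condScore_le hpriv x z

-- Privacy bounds `p y z`, for `y` in the unit ball around `x`, by a constant multiple of `p x z`:
-- this is the domination that allows differentiating under the integral.
lemma hasFDerivAt_integral_law (hp : IsPosCondDensity p)
    (hdiff : ∀ z, Differentiable ℝ fun x => Real.log (p x z)) (hpriv : IsLipschitzPrivate ε p)
    {x : EuclideanSpace ℝ (Fin d)} (hh : Integrable h (law (p x))) :
    HasFDerivAt (fun y => ∫ z, h z ∂(law (p y)))
      (∫ z, rankOne ℝ (h z) (condScore p x z) ∂(law (p x))) x := by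
  have hmeas : AEStronglyMeasurable h := hh.1.mono_ac (hp.density x).volume_absolutelyContinuous_law
  have hhx := (hp.density x).integrable_law_iff.1 hh
  have hscore := (hp.density x).integrable_law_iff.1
    (integrable_rankOne_condScore hp (fun z => hdiff z x) hpriv hh)
  simp only [(hp.density _).integral_law]
  refine hasFDerivAt_integral_of_dominated_of_fderiv_le
    (F' := fun y z => p y z • rankOne ℝ (h z) (condScore p y z))
    (bound := fun z => Real.exp |ε| * |ε| * ‖p x z • h z‖) (Metric.ball_mem_nhds x one_pos)
    (.of_forall fun y => (hp.density y).measurable.aestronglyMeasurable.smul hmeas) hhx hscore.1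
    (.of_forall fun z y hy => ?_) (hhx.norm.const_mul _) (.of_forall fun z y _ => ?_)
  · have hdens : p y z ≤ Real.exp |ε| * p x z := by
      refine (condDensity_le_exp_mul hp (hdiff z) hpriv x y).trans ?_
      have hyx : ‖y - x‖ ≤ 1 := (mem_ball_iff_norm.1 hy).le
      have := ((hp.density x).pos z).le
      gcongr
      exact mul_le_of_le_one_right (abs_nonneg ε) hyx
    rw [norm_smul, norm_smul, norm_rankOne, Real.norm_of_nonneg ((hp.density x).pos z).le,
      Real.norm_of_nonneg ((hp.density y).pos z).le]
    calc p y z * (‖h z‖ * ‖condScore p y z‖) ≤ Real.exp |ε| * p x z * (‖h z‖ * |ε|) := by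
          gcongr
          · exact ((hp.density y).pos z).le.trans hdens
          · exact norm_condScore_le hpriv y z
      _ = Real.exp |ε| * |ε| * (p x z * ‖h z‖) := by ring
  · convert (hasFDerivAt_condDensity hp (hdiff z y)).smul_const (h z) using 1
    ext v
    simp [smul_smul]

lemma integral_condScore_apply (hp : IsPosCondDensity p)
    (hdiff : ∀ z, Differentiable ℝ fun x => Real.log (p x z)) (hpriv : IsLipschitzPrivate ε p)
    (x : EuclideanSpace ℝ (Fin d)) (j : Fin d) : ∫ z, condScore p x z j ∂(law (p x)) = 0 := by
  have hprob := fun y => (hp.density y).isProbabilityMeasure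
  have hderiv := hasFDerivAt_integral_law (x := x) hp hdiff hpriv (integrable_const (1 : ℝ))
  simp only [integral_const, probReal_univ, smul_eq_mul, mul_one] at hderiv
  have hzero := DFunLike.congr_fun (hderiv.unique (hasFDerivAt_const 1 x))
    (EuclideanSpace.single j 1)
  rw [ContinuousLinearMap.integral_apply (integrable_rankOne_condScore hp (fun z => hdiff z x)
    hpriv (integrable_const 1))] at hzero
  simpa [EuclideanSpace.inner_single_right] using hzero

end Differentiation

section ConditionalMean

variable {A : EuclideanSpace ℝ (Fin m) → EuclideanSpace ℝ (Fin d)} {x : EuclideanSpace ℝ (Fin d)}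

lemma differentiableAt_condMean (hp : IsPosCondDensity p)
    (hdiff : ∀ z, Differentiable ℝ fun x => Real.log (p x z)) (hpriv : IsLipschitzPrivate ε p)
    (hA : Integrable A (law (p x))) : DifferentiableAt ℝ (condMean p A) x :=
  (hasFDerivAt_integral_law hp hdiff hpriv hA).differentiableAt

lemma jacobian_condMean_apply (hp : IsPosCondDensity p)
    (hdiff : ∀ z, Differentiable ℝ fun x => Real.log (p x z)) (hpriv : IsLipschitzPrivate ε p)
    (hA : Integrable A (law (p x))) (i j : Fin d) :
    jacobian (condMean p A) x i j = ∫ z, A z i * condScore p x z j ∂(law (p x)) := by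
  have hderiv : HasFDerivAt (condMean p A) _ x := hasFDerivAt_integral_law hp hdiff hpriv hA
  have hcomm := ((EuclideanSpace.proj (𝕜 := ℝ) i).comp
    (ContinuousLinearMap.apply ℝ _ (EuclideanSpace.single j 1))).integral_comp_comm
      (integrable_rankOne_condScore hp (fun z => hdiff z x) hpriv hA)
  simp only [jacobian, Matrix.of_apply, hderiv.fderiv]
  simpa [EuclideanSpace.inner_single_right, mul_comm] using hcomm.symm

lemma jacobian_condMean_eq_covariance (hp : IsPosCondDensity p)
    (hdiff : ∀ z, Differentiable ℝ fun x => Real.log (p x z)) (hpriv : IsLipschitzPrivate ε p)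
    (hA : MemLp A 2 (law (p x))) (i j : Fin d) :
    jacobian (condMean p A) x i j =
      cov[fun z => A z i, fun z => condScore p x z j; law (p x)] := by
  have := (hp.density x).isProbabilityMeasure
  rw [jacobian_condMean_apply hp hdiff hpriv (hA.integrable one_le_two),
    covariance_eq_sub (hA.eval_piLp i)
      ((memLp_condScore hp (fun z => hdiff z x) hpriv 2).eval_piLp j),
    integral_condScore_apply hp hdiff hpriv, mul_zero, sub_zero]
  rfl

lemma jacobian_id (x : EuclideanSpace ℝ (Fin d)) : jacobian (fun y => y) x = 1 := by
  ext i j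
  simp [jacobian, Matrix.one_apply]

end ConditionalMean

section InformationBounds

variable {A : EuclideanSpace ℝ (Fin m) → EuclideanSpace ℝ (Fin d)} {x : EuclideanSpace ℝ (Fin d)}

lemma integrable_condScore_mul (hp : IsPosCondDensity p)
    (hdiff : ∀ z, DifferentiableAt ℝ (fun y => Real.log (p y z)) x)
    (hpriv : IsLipschitzPrivate ε p) (i j : Fin d) :
    Integrable (fun z => condScore p x z i * condScore p x z j) (law (p x)) :=
  have hscore := memLp_condScore hp hdiff hpriv 2
  (hscore.eval_piLp i).integrable_mul (hscore.eval_piLp j)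

lemma condFisher_posSemidef (hp : IsPosCondDensity p)
    (hdiff : ∀ z, DifferentiableAt ℝ (fun y => Real.log (p y z)) x)
    (hpriv : IsLipschitzPrivate ε p) : (condFisher p x).PosSemidef :=
  posSemidef_secondMoment (S := fun i z => condScore p x z i)
    (integrable_condScore_mul hp hdiff hpriv)

lemma trace_condFisher_le (hp : IsPosCondDensity p)
    (hdiff : ∀ z, DifferentiableAt ℝ (fun y => Real.log (p y z)) x)
    (hpriv : IsLipschitzPrivate ε p) : (condFisher p x).trace ≤ ε ^ 2 := by
  have := (hp.density x).isProbabilityMeasure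
  have hscore := memLp_condScore hp hdiff hpriv 2
  calc (condFisher p x).trace = ∫ z, ‖condScore p x z‖ ^ 2 ∂(law (p x)) := by
        simp only [EuclideanSpace.real_norm_sq_eq]
        exact trace_secondMoment (S := fun i z => condScore p x z i)
          fun i => integrable_condScore_mul hp hdiff hpriv i i
    _ ≤ ∫ _, ε ^ 2 ∂(law (p x)) :=
        integral_mono ((memLp_two_iff_integrable_sq_norm hscore.1).1 hscore)
          (integrable_const _) (hpriv x)
    _ = ε ^ 2 := by simp

lemma sq_div_le_trace_inv_condFisher_add (hp : IsPosCondDensity p)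
    (hdiff : ∀ z, DifferentiableAt ℝ (fun y => Real.log (p y z)) x)
    (hpriv : IsLipschitzPrivate ε p) {K : Matrix (Fin d) (Fin d) ℝ}
    (hpos : (condFisher p x + K).PosDef) :
    (d : ℝ) ^ 2 / (ε ^ 2 + K.trace) ≤ (condFisher p x + K)⁻¹.trace := by
  have htrace : (condFisher p x + K).trace ≤ ε ^ 2 + K.trace := by
    rw [trace_add]
    gcongr
    exact trace_condFisher_le hp hdiff hpriv
  simpa only [Fintype.card_fin] using sq_card_div_le_trace_inv hpos htrace

lemma trace_jacobian_add_norm_sq_le_integral (hp : IsPosCondDensity p)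
    (hdiff : ∀ z, Differentiable ℝ fun x => Real.log (p x z)) (hpriv : IsLipschitzPrivate ε p)
    (hA : MemLp A 2 (law (p x))) {M : Matrix (Fin d) (Fin d) ℝ} (hM : M.PosDef)
    (hle : (M - condFisher p x).PosSemidef) (c : EuclideanSpace ℝ (Fin d)) :
    (jacobian (condMean p A) x * M⁻¹ * (jacobian (condMean p A) x)ᵀ).trace +
        ‖condMean p A x - c‖ ^ 2 ≤ ∫ z, ‖A z - c‖ ^ 2 ∂(law (p x)) := by
  have := (hp.density x).isProbabilityMeasure
  have hscore := memLp_condScore hp (fun z => hdiff z x) hpriv 2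
  rw [trace_mul_mul_transpose_eq_sum, integral_norm_sub_sq_eq_sum_variance_add hA c]
  refine add_le_add_left (Finset.sum_le_sum fun i _ => ?_) _
  have hrow : jacobian (condMean p A) x i =
      fun j => cov[fun z => A z i, fun z => condScore p x z j; law (p x)] :=
    funext (jacobian_condMean_eq_covariance hp hdiff hpriv hA i)
  rw [hrow]
  exact cov_dotProduct_inv_mulVec_cov_le_variance (hA.eval_piLp i) hscore.eval_piLp hM hle

lemma ofReal_trace_jacobian_add_norm_sq_le_lintegral (hp : IsPosCondDensity p)
    (hdiff : ∀ z, Differentiable ℝ fun x => Real.log (p x z)) (hpriv : IsLipschitzPrivate ε p)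
    (hA : AEStronglyMeasurable A (law (p x))) {M : Matrix (Fin d) (Fin d) ℝ} (hM : M.PosDef)
    (hle : (M - condFisher p x).PosSemidef) (c : EuclideanSpace ℝ (Fin d)) :
    ENNReal.ofReal ((jacobian (condMean p A) x * M⁻¹ * (jacobian (condMean p A) x)ᵀ).trace +
        ‖condMean p A x - c‖ ^ 2) ≤ ∫⁻ z, ENNReal.ofReal (‖A z - c‖ ^ 2) ∂(law (p x)) := by
  have := (hp.density x).isProbabilityMeasure
  have hAc : AEStronglyMeasurable (fun z => A z - c) (law (p x)) :=
    hA.sub aestronglyMeasurable_const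
  have hnonneg : 0 ≤ᵐ[law (p x)] fun z => ‖A z - c‖ ^ 2 := .of_forall fun z => sq_nonneg _
  by_cases htop : ∫⁻ z, ENNReal.ofReal (‖A z - c‖ ^ 2) ∂(law (p x)) = ⊤
  · exact le_of_le_of_eq le_top htop.symm
  have hint : Integrable (fun z => ‖A z - c‖ ^ 2) (law (p x)) :=
    (lintegral_ofReal_ne_top_iff_integrable (hAc.norm.pow 2) hnonneg).1 htop
  have hA2 : MemLp A 2 (law (p x)) := by
    simpa only [Pi.add_def, sub_add_cancel] using
      ((memLp_two_iff_integrable_sq_norm hAc).2 hint).add (memLp_const c)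
  rw [← ofReal_integral_eq_lintegral_ofReal hint hnonneg]
  exact ENNReal.ofReal_le_ofReal
    (trace_jacobian_add_norm_sq_le_integral hp hdiff hpriv hA2 hM hle c)

end InformationBounds

section JointLaw

/-- The Markov kernel `x ↦ p_Z(· | x) dz` of a mechanism, through which the joint law of `(X, Z)`
makes sense for a prior without density. It is a junk value unless `p` is jointly measurable. -/
noncomputable def mechanismKernel
    (p : EuclideanSpace ℝ (Fin d) → EuclideanSpace ℝ (Fin m) → ℝ) :
    Kernel (EuclideanSpace ℝ (Fin d)) (EuclideanSpace ℝ (Fin m)) :=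
  (Kernel.const _ volume).withDensity fun x z => ENNReal.ofReal (p x z)

instance : IsSFiniteKernel (mechanismKernel p) :=
  Kernel.IsSFiniteKernel.withDensity _ fun _ _ => ENNReal.ofReal_ne_top

lemma mechanismKernel_apply (hp : Measurable (Function.uncurry p)) (x : EuclideanSpace ℝ (Fin d)) :
    mechanismKernel p x = law (p x) := by
  rw [mechanismKernel, Kernel.withDensity_apply _ hp.ennreal_ofReal, Kernel.const_apply, law]

lemma compProd_mechanismKernel (hp : Measurable (Function.uncurry p))
    {f : EuclideanSpace ℝ (Fin d) → ℝ} (hf : IsPosDensity f) :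
    law f ⊗ₘ mechanismKernel p = jointLaw f p := by
  have hpm : Measurable fun w : EuclideanSpace ℝ (Fin d) × EuclideanSpace ℝ (Fin m) =>
      ENNReal.ofReal (p w.1 w.2) := hp.ennreal_ofReal
  have hfm : Measurable fun w : EuclideanSpace ℝ (Fin d) × EuclideanSpace ℝ (Fin m) =>
      ENNReal.ofReal (f w.1) := (hf.measurable.comp measurable_fst).ennreal_ofReal
  have := hf.isProbabilityMeasure
  have hker : IsSFiniteKernel (mechanismKernel p) := inferInstance
  rw [mechanismKernel] at hker ⊢
  rw [Measure.compProd_withDensity hpm, Measure.compProd_const, law,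
    prod_withDensity_left hf.measurable.ennreal_ofReal, ← Measure.volume_eq_prod,
    ← withDensity_mul _ hfm hpm, jointLaw]
  simp only [Pi.mul_def, ENNReal.ofReal_mul (hf.pos _).le]

lemma reconstructionError_eq_lintegral {Ω : Type*} [MeasurableSpace Ω] {P : Measure Ω}
    {π : Measure (EuclideanSpace ℝ (Fin d))} [SFinite π] (hp : Measurable (Function.uncurry p))
    {X : Ω → EuclideanSpace ℝ (Fin d)} {Z : Ω → EuclideanSpace ℝ (Fin m)}
    (hXZ : HasLaw (fun ω => (X ω, Z ω)) (π ⊗ₘ mechanismKernel p) P)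
    {A : EuclideanSpace ℝ (Fin m) → EuclideanSpace ℝ (Fin d)} (hA : Measurable A) :
    reconstructionError P X Z A =
      ∫⁻ x, ∫⁻ z, ENNReal.ofReal (‖A z - x‖ ^ 2) ∂(law (p x)) ∂π := by
  have hloss : Measurable fun w : EuclideanSpace ℝ (Fin d) × EuclideanSpace ℝ (Fin m) =>
      ENNReal.ofReal (‖A w.2 - w.1‖ ^ 2) := by fun_prop
  calc reconstructionError P X Z A
      = ∫⁻ w, ENNReal.ofReal (‖A w.2 - w.1‖ ^ 2) ∂(π ⊗ₘ mechanismKernel p) :=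
        hXZ.lintegral_comp hloss.aemeasurable
    _ = ∫⁻ x, ∫⁻ z, ENNReal.ofReal (‖A z - x‖ ^ 2) ∂(law (p x)) ∂π := by
        simp only [Measure.lintegral_compProd hloss, mechanismKernel_apply hp]

end JointLaw

end Reconstruction

open Reconstruction in
theorem theorem3_general {Ω : Type*} [MeasurableSpace Ω] {P : Measure Ω} {d m : ℕ} {ε : ℝ}
    {π : Measure (EuclideanSpace ℝ (Fin d))} [IsProbabilityMeasure π]
    {p : EuclideanSpace ℝ (Fin d) → EuclideanSpace ℝ (Fin m) → ℝ} (hp : IsPosCondDensity p)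
    {X : Ω → EuclideanSpace ℝ (Fin d)} {Z : Ω → EuclideanSpace ℝ (Fin m)}
    (hXZ : HasLaw (fun ω => (X ω, Z ω)) (π ⊗ₘ mechanismKernel p) P)
    (hdiff : ∀ z, Differentiable ℝ fun x => Real.log (p x z)) (hpriv : IsLipschitzPrivate ε p)
    {K : Matrix (Fin d) (Fin d) ℝ} (hK : K.PosSemidef)
    (hnull : ∀ x, LinearMap.ker (condFisher p x).mulVecLin ⊓ LinearMap.ker K.mulVecLin = ⊥)
    {A : EuclideanSpace ℝ (Fin m) → EuclideanSpace ℝ (Fin d)} (hA : Measurable A)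
    (hAint : ∀ x, Integrable A (law (p x))) :
    Differentiable ℝ (condMean p A) ∧
    (∀ x, (condFisher p x + K).PosDef) ∧
    ∫⁻ x, ENNReal.ofReal ((jacobian (condMean p A) x * (condFisher p x + K)⁻¹ *
        (jacobian (condMean p A) x).transpose).trace + ‖condMean p A x - x‖ ^ 2) ∂π
      ≤ reconstructionError P X Z A ∧
    ((∀ x, condMean p A x = x) →
      ∫⁻ x, ENNReal.ofReal ((condFisher p x + K)⁻¹.trace) ∂π ≤ reconstructionError P X Z A ∧
      (∀ x, (d : ℝ) ^ 2 / (ε ^ 2 + K.trace) ≤ (condFisher p x + K)⁻¹.trace) ∧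
      ENNReal.ofReal ((d : ℝ) ^ 2 / (ε ^ 2 + K.trace)) ≤ reconstructionError P X Z A) := by
  have hpos : ∀ x, (condFisher p x + K).PosDef := fun x =>
    posDef_add_of_ker_inf_ker_eq_bot (condFisher_posSemidef hp (fun z => hdiff z x) hpriv) hK
      (hnull x)
  have hbound : ∫⁻ x, ENNReal.ofReal ((jacobian (condMean p A) x * (condFisher p x + K)⁻¹ *
      (jacobian (condMean p A) x).transpose).trace + ‖condMean p A x - x‖ ^ 2) ∂π
        ≤ reconstructionError P X Z A := by
    rw [reconstructionError_eq_lintegral hp.measurable hXZ hA]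
    exact lintegral_mono fun x => ofReal_trace_jacobian_add_norm_sq_le_lintegral hp hdiff hpriv
      hA.aestronglyMeasurable (hpos x) (by rwa [add_sub_cancel_left]) x
  have htrace := fun x => sq_div_le_trace_inv_condFisher_add hp (fun z => hdiff z x) hpriv (hpos x)
  refine ⟨fun x => differentiableAt_condMean hp hdiff hpriv (hAint x), hpos, hbound,
    fun hmean => ?_⟩
  have hunbiased : ∫⁻ x, ENNReal.ofReal ((condFisher p x + K)⁻¹.trace) ∂π
      ≤ reconstructionError P X Z A := by
    simpa [show condMean p A = fun x => x from funext hmean, jacobian_id] using hbound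
  refine ⟨hunbiased, htrace, ?_⟩
  calc ENNReal.ofReal ((d : ℝ) ^ 2 / (ε ^ 2 + K.trace))
      = ∫⁻ _, ENNReal.ofReal ((d : ℝ) ^ 2 / (ε ^ 2 + K.trace)) ∂π := by simp
    _ ≤ ∫⁻ x, ENNReal.ofReal ((condFisher p x + K)⁻¹.trace) ∂π :=
        lintegral_mono fun x => ENNReal.ofReal_le_ofReal (htrace x)
    _ ≤ reconstructionError P X Z A := hunbiased

theorem theorem3 {Ω : Type*} [MeasurableSpace Ω] (P : Measure Ω) [IsProbabilityMeasure P]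
    {d m : ℕ} (ε : ℝ) (hε : 0 < ε)
    (f : EuclideanSpace ℝ (Fin d) → ℝ) (hf : Reconstruction.IsPosDensity f)
    (p : EuclideanSpace ℝ (Fin d) → EuclideanSpace ℝ (Fin m) → ℝ)
    (hp : Reconstruction.IsPosCondDensity p)
    (X : Ω → EuclideanSpace ℝ (Fin d)) (Z : Ω → EuclideanSpace ℝ (Fin m))
    (hXZ : HasLaw (fun ω => (X ω, Z ω)) (Reconstruction.jointLaw f p) P)
    (hf2 : Reconstruction.TwiceDifferentiable fun x => Real.log (f x))
    (hp2 : ∀ z, Reconstruction.TwiceDifferentiable fun x => Real.log (p x z))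
    (hpriv : Reconstruction.IsLipschitzPrivate ε p)
    (hfisher : Reconstruction.FinitePriorFisher f)
    (hnull : ∀ x, LinearMap.ker (Reconstruction.condFisher p x).mulVecLin ⊓
      LinearMap.ker (Reconstruction.priorFisher f).mulVecLin = ⊥)
    (A : EuclideanSpace ℝ (Fin m) → EuclideanSpace ℝ (Fin d)) (hA : Measurable A)
    (hAint : ∀ x, Integrable A (Reconstruction.law (p x))) :
    Differentiable ℝ (Reconstruction.condMean p A) ∧
    (∀ x, (Reconstruction.totalFisher f p x).PosDef) ∧
    ∫⁻ x, ENNReal.ofReal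
        ((Reconstruction.jacobian (Reconstruction.condMean p A) x *
            (Reconstruction.totalFisher f p x)⁻¹ *
            (Reconstruction.jacobian (Reconstruction.condMean p A) x).transpose).trace +
          ‖Reconstruction.condMean p A x - x‖ ^ 2) ∂(Reconstruction.law f)
      ≤ Reconstruction.reconstructionError P X Z A ∧
    ((∀ x, Reconstruction.condMean p A x = x) →
      ∫⁻ x, ENNReal.ofReal ((Reconstruction.totalFisher f p x)⁻¹.trace) ∂(Reconstruction.law f)
          ≤ Reconstruction.reconstructionError P X Z A ∧
      (∀ x, (d : ℝ) ^ 2 / (ε ^ 2 + (Reconstruction.priorFisher f).trace)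
          ≤ (Reconstruction.totalFisher f p x)⁻¹.trace) ∧
      ENNReal.ofReal ((d : ℝ) ^ 2 / (ε ^ 2 + (Reconstruction.priorFisher f).trace))
          ≤ Reconstruction.reconstructionError P X Z A) :=
  have := hf.isProbabilityMeasure
  theorem3_general hp (Reconstruction.compProd_mechanismKernel hp.measurable hf ▸ hXZ)
    (fun z => (hp2 z).1) hpriv (Reconstruction.posSemidef_secondMoment hfisher) hnull hA hAint
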